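/- Let $R$ be a left and right Noetherian ring (associative, with identity). A (left or right) module $G$ over a ring is called Gorenstein projective if there is an exact sequence of (not necessarily finitely generated) projective modules $\cdots \to P_1 \to P_0 \to P^0 \to P^1 \to \cdots$ that stays exact after applying $\operatorname{Hom}(-,Q)$ for every projective module $Q$, and such that $G \cong \operatorname{Im}(P_0 \to P^0)$. Write $(-)^* = \operatorname{Hom}_R(-,R)$, which sends left $R$-modules to right $R$-modules. Let $A$ be a finitely generated left $R$-module. A right $R$-module is called a transpose of $A$ if it is isomorphic to $\operatorname{Coker}(f^*\colon P_0^* \to P_1^*)$ for some exact sequence $P_1 \xrightarrow{f} P_0 \to A \to 0$ of left $R$-modules with $P_0, P_1$ finitely generated projective. It is called a Gorenstein transpose of $A$ if it is isomorphic to $\operatorname{Coker}(g^*\colon X_0^* \to X_1^*)$ for some exact sequence $X_1 \xrightarrow{g} X_0 \to A \to 0$ of left $R$-modules with $X_0, X_1$ finitely generated Gorenstein projective. Corollary 3.2. For every finitely generated Gorenstein projective right $R$-module $H$ and every transpose $\operatorname{Tr} A$ of $A$, the right $R$-module $H \oplus \operatorname{Tr} A$ is a Gorenstein transpose of $A$.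 -/

import Mathlib

universe u

/-!
Left `R`-modules are `Module R M`; right `R`-modules are `Module Rᵐᵒᵖ M`.
For a left `R`-module `M`, the dual `M →ₗ[R] R` carries Mathlib's right module structure,
given by `(φ r) x = φ x * r`.
-/

namespace GorTranspose

/-- Exact (unbounded) complexes of projective `R`-modules
`⋯ → P (-1) → P 0 → P 1 → ⋯` which stay exact under `Hom_R(-, Q)` for every projective
`R`-module `Q`. -/
structure CompleteProjRes (R : Type u) [Ring R] where
  /-- the terms of the complex -/
  P : ℤ → ModuleCat.{u} R
  /-- the differentials -/
  d : ∀ n : ℤ, P n →ₗ[R] P (n + 1)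
  projective : ∀ n : ℤ, Module.Projective R (P n)
  exact : ∀ n : ℤ, Function.Exact (d n) (d (n + 1))
  /-- exactness of `Hom(P (n+2), Q) → Hom(P (n+1), Q) → Hom(P n, Q)` at the middle term -/
  hom_exact : ∀ (Q : Type u) [AddCommGroup Q] [Module R Q], Module.Projective R Q → ∀ n : ℤ,
    Function.Exact (fun h : P (n + 1 + 1) →ₗ[R] Q => h ∘ₗ d (n + 1))
      (fun g : P (n + 1) →ₗ[R] Q => g ∘ₗ d n)

/-- `G` is Gorenstein projective: it is isomorphic to the image of a differential of an exact
complex of projectives that stays exact under `Hom_R(-, Q)` for all projective `Q`. -/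
def IsGorensteinProjective (R : Type u) [Ring R] (G : Type u) [AddCommGroup G] [Module R G] :
    Prop :=
  ∃ C : CompleteProjRes R, Nonempty (G ≃ₗ[R] LinearMap.range (C.d 0))

section Dual

variable {R : Type u} [Ring R] {M N : Type u} [AddCommGroup M] [Module R M]
  [AddCommGroup N] [Module R N]

/-- The dual `f^* : N^* → M^*`, `φ ↦ φ ∘ f`, of a map `f : M → N` of left `R`-modules, as a map
of right `R`-modules. -/
def dualMap (f : M →ₗ[R] N) : (N →ₗ[R] R) →ₗ[Rᵐᵒᵖ] (M →ₗ[R] R) where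
  toFun φ := φ ∘ₗ f
  map_add' _ _ := rfl
  map_smul' _ _ := rfl

/-- The cokernel of `f^* : N^* → M^*`, a right `R`-module. -/
abbrev CokerDual (f : M →ₗ[R] N) : Type u :=
  (M →ₗ[R] R) ⧸ LinearMap.range (dualMap f)

end Dual

/-- The right `R`-module `T` is (isomorphic to) a transpose of the left `R`-module `A`: there is
an exact sequence `P₁ → P₀ → A → 0` with `P₁`, `P₀` finitely generated projective, with first
map `f`, such that `T ≅ Coker f^*`. -/
def IsTranspose (R : Type u) [Ring R] (A : Type u) [AddCommGroup A] [Module R A]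
    (T : Type u) [AddCommGroup T] [Module Rᵐᵒᵖ T] : Prop :=
  ∃ (P₁ P₀ : ModuleCat.{u} R) (f : P₁ →ₗ[R] P₀) (p : P₀ →ₗ[R] A),
    Module.Finite R P₁ ∧ Module.Finite R P₀ ∧
    Module.Projective R P₁ ∧ Module.Projective R P₀ ∧
    Function.Exact f p ∧ Function.Surjective p ∧
    Nonempty (T ≃ₗ[Rᵐᵒᵖ] CokerDual f)

/-- The right `R`-module `T` is (isomorphic to) a Gorenstein transpose of the left `R`-module
`A`: there is an exact sequence `X₁ → X₀ → A → 0` with `X₁`, `X₀` finitely generated Gorenstein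
projective, with first map `g`, such that `T ≅ Coker g^*`. -/
def IsGorensteinTranspose (R : Type u) [Ring R] (A : Type u) [AddCommGroup A] [Module R A]
    (T : Type u) [AddCommGroup T] [Module Rᵐᵒᵖ T] : Prop :=
  ∃ (X₁ X₀ : ModuleCat.{u} R) (g : X₁ →ₗ[R] X₀) (p : X₀ →ₗ[R] A),
    Module.Finite R X₁ ∧ Module.Finite R X₀ ∧
    IsGorensteinProjective R X₁ ∧ IsGorensteinProjective R X₀ ∧
    Function.Exact g p ∧ Function.Surjective p ∧
    Nonempty (T ≃ₗ[Rᵐᵒᵖ] CokerDual g)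

end GorTranspose

/-! It suffices to write `H` as `Coker q^*` for a surjection `q : Q → K` of left modules with `Q`
finitely generated projective and `K` Gorenstein projective. Adding `q` to a presentation `f : P₁ →
P₀` of `A` keeps the cokernel `A`, because `q` is onto, and keeps the terms finitely generated
Gorenstein projective. Since `Coker` of the dual respects direct sums, the result is a presentation
with Gorenstein transpose `H ⊕ Coker f^*` (`nonempty_cokerDual_prodMap_equiv`).

To obtain `q` (`exists_cokerDual_equiv`), take `0 → M → F → H → 0` with `F` free of finite rank and
set `q : F^* → M^*`. This is onto if maps `M → R` extend to `F`; as `F` is reflexive and `H` is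
torsionless, `Coker q^* ≅ H`. For `M^*` to be Gorenstein projective, `H` must sit in a bi-infinite
complex of finite free modules whose dual is again a complete resolution.

The given resolution of `H` may have infinitely generated terms. The remedy is to work up to
projective summands: `IsStableSyzygy` modules extend by finite free modules in both directions
(`IsStableSyzygy.exists_right`, `IsStableSyzygy.exists_left`), and the short exact sequences splice.
-/

namespace GorTranspose

/-! ### Complete resolutions and their syzygies -/

section Generic

variable {S : Type u} [Ring S]

/-- The complex obtained from `C` by adding a contractible complex all of whose cycles are `F`. -/
def CompleteProjRes.addProjective (C : CompleteProjRes S) (F : Type u) [AddCommGroup F]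
    [Module S F] [Module.Projective S F] : CompleteProjRes S where
  P n := ModuleCat.of S (C.P n × F × F)
  d n := (C.d n).prodMap (LinearMap.inr S F F ∘ₗ LinearMap.fst S F F)
  projective n := by
    have := C.projective n
    exact inferInstanceAs (Module.Projective S (C.P n × F × F))
  exact n := by
    rintro ⟨x, a, b⟩
    have := C.exact n x
    constructor
    · intro h
      obtain ⟨h1, h2⟩ := Prod.ext_iff.1 h
      obtain ⟨y, hy⟩ := this.1 h1
      have h3 : a = 0 := (Prod.ext_iff.1 h2).2
      exact ⟨(y, b, 0), Prod.ext hy (Prod.ext h3.symm rfl)⟩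
    · rintro ⟨⟨y, c, e⟩, hy⟩
      obtain ⟨h1, h2⟩ := Prod.ext_iff.1 hy
      have h3 : 0 = a := (Prod.ext_iff.1 h2).1
      exact Prod.ext (this.2 ⟨y, h1⟩) (Prod.ext rfl h3.symm)
  hom_exact Q _ _ hQ n := by
    intro (g : C.P (n + 1) × F × F →ₗ[S] Q)
    have key := C.hom_exact Q hQ n (g ∘ₗ LinearMap.inl S _ _)
    constructor
    · intro h
      have h0 : ∀ y : C.P n × F × F, g (C.d n y.1, 0, y.2.1) = 0 := fun y =>
        LinearMap.congr_fun h y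
      obtain ⟨k, hk⟩ := key.1 (LinearMap.ext fun y => h0 (y, 0, 0))
      refine ⟨(k.coprod ((g ∘ₗ LinearMap.inr S (C.P (n + 1)) (F × F) ∘ₗ LinearMap.inl S F F) ∘ₗ
        LinearMap.snd S F F) : C.P (n + 1 + 1) × F × F →ₗ[S] Q),
        LinearMap.ext fun (y : C.P (n + 1) × F × F) => ?_⟩
      obtain ⟨y, a, b⟩ := y
      have h1 : k (C.d (n + 1) y) = g (y, 0, 0) := LinearMap.congr_fun hk y
      -- The last copy of `F` consists of boundaries, so `g` vanishes there and only its value on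
      -- the first copy has to be carried over.
      have h2 : g (0, 0, b) = 0 := by simpa using h0 (0, b, 0)
      have h3 : g (y, a, b) = g (y, 0, 0) + g (0, a, 0) + g (0, 0, b) := by
        rw [← map_add, ← map_add]; simp
      change k (C.d (n + 1) y) + g (0, a, 0) = g (y, a, b)
      rw [h1, h3, h2, add_zero]
    · rintro ⟨(k : C.P (n + 1 + 1) × F × F →ₗ[S] Q), rfl⟩
      refine LinearMap.ext fun (y : C.P n × F × F) => ?_
      change k (C.d (n + 1) (C.d n y.1), 0, 0) = 0
      rw [(C.exact n).apply_apply_eq_zero, ← Prod.zero_eq_mk, ← Prod.zero_eq_mk, map_zero]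

theorem CompleteProjRes.nonempty_range_addProjective (C : CompleteProjRes S) (F : Type u)
    [AddCommGroup F] [Module S F] [Module.Projective S F] (n : ℤ) :
    Nonempty ((LinearMap.range (C.d n) × F) ≃ₗ[S]
      LinearMap.range ((C.addProjective F).d n)) := by
  let f : LinearMap.range (C.d n) × F →ₗ[S] C.P (n + 1) × F × F :=
    (LinearMap.range (C.d n)).subtype.prodMap (LinearMap.inr S F F)
  have hf : Function.Injective f := by
    rintro ⟨x, a⟩ ⟨y, b⟩ h
    obtain ⟨h1, h2⟩ := Prod.ext_iff.1 h
    exact Prod.ext (Subtype.ext h1) (Prod.ext_iff.1 h2).2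
  have hr : LinearMap.range f = LinearMap.range ((C.addProjective F).d n) := by
    apply SetLike.ext
    intro x
    constructor
    · rintro ⟨⟨⟨_, y, rfl⟩, a⟩, rfl⟩
      exact ⟨((y, a, 0) : C.P n × F × F), rfl⟩
    · rintro ⟨(⟨y, a, b⟩ : C.P n × F × F), rfl⟩
      exact ⟨(⟨_, y, rfl⟩, a), rfl⟩
  exact ⟨(LinearEquiv.ofInjective f hf).trans (LinearEquiv.ofEq _ _ hr)⟩

/-- `G` is isomorphic to the image of some differential of a complete projective resolution. -/
def IsSyzygy (S : Type u) [Ring S] (G : Type u) [AddCommGroup G] [Module S G] : Prop :=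
  ∃ (C : CompleteProjRes S) (n : ℤ), Nonempty (G ≃ₗ[S] LinearMap.range (C.d n))

variable {G : Type u} [AddCommGroup G] [Module S G]

theorem IsGorensteinProjective.isSyzygy (h : IsGorensteinProjective S G) : IsSyzygy S G :=
  let ⟨C, e⟩ := h; ⟨C, 0, e⟩

theorem IsGorensteinProjective.prod (h : IsGorensteinProjective S G) (F : Type u)
    [AddCommGroup F] [Module S F] [Module.Projective S F] :
    IsGorensteinProjective S (G × F) := by
  obtain ⟨C, ⟨e⟩⟩ := h
  obtain ⟨e'⟩ := C.nonempty_range_addProjective F 0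
  exact ⟨_, ⟨(e.prodCongr (LinearEquiv.refl S F)).trans e'⟩⟩

theorem IsSyzygy.prod (h : IsSyzygy S G) (F : Type u)
    [AddCommGroup F] [Module S F] [Module.Projective S F] : IsSyzygy S (G × F) := by
  obtain ⟨C, n, ⟨e⟩⟩ := h
  obtain ⟨e'⟩ := C.nonempty_range_addProjective F n
  exact ⟨_, n, ⟨(e.prodCongr (LinearEquiv.refl S F)).trans e'⟩⟩

theorem IsGorensteinProjective.of_equiv {G' : Type u} [AddCommGroup G'] [Module S G']
    (h : IsGorensteinProjective S G) (e : G' ≃ₗ[S] G) : IsGorensteinProjective S G' :=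
  let ⟨C, ⟨f⟩⟩ := h; ⟨C, ⟨e.trans f⟩⟩

theorem IsSyzygy.of_equiv {G' : Type u} [AddCommGroup G'] [Module S G']
    (h : IsSyzygy S G) (e : G' ≃ₗ[S] G) : IsSyzygy S G' :=
  let ⟨C, n, ⟨f⟩⟩ := h; ⟨C, n, ⟨e.trans f⟩⟩

/-- The zero complex. -/
def CompleteProjRes.zero (S : Type u) [Ring S] : CompleteProjRes S where
  P _ := ModuleCat.of S PUnit.{u+1}
  d _ := 0
  projective _ := inferInstanceAs (Module.Projective S PUnit.{u+1})
  exact _ _ := ⟨fun _ => ⟨PUnit.unit, rfl⟩, fun _ => rfl⟩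
  hom_exact Q _ _ _ _ := fun (g : PUnit.{u+1} →ₗ[S] Q) =>
    ⟨fun _ => ⟨0, LinearMap.ext fun (_ : PUnit.{u+1}) => (map_zero g).symm⟩, fun _ =>
      LinearMap.ext fun (_ : PUnit.{u+1}) => map_zero g⟩

theorem isGorensteinProjective_of_subsingleton [Subsingleton G] :
    IsGorensteinProjective S G := by
  have : Subsingleton (LinearMap.range ((CompleteProjRes.zero S).d 0)) :=
    ⟨fun _ _ => Subtype.ext rfl⟩
  exact ⟨CompleteProjRes.zero S, ⟨LinearEquiv.ofSubsingleton _ _⟩⟩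

/-- A projective module is a cycle module of a contractible complex, here added to the zero complex.
-/
theorem isGorensteinProjective_of_projective [Module.Projective S G] :
    IsGorensteinProjective S G :=
  ((isGorensteinProjective_of_subsingleton (G := PUnit.{u+1})).prod G).of_equiv
    (LinearEquiv.uniqueProd (R := S) (M := G) (M₂ := PUnit.{u+1})).symm

/-- The next term of the complex receives `G`. A map from `G` to a projective pulls back to the
preceding term as a cocycle, and `Hom`-exactness extends it. -/
theorem IsSyzygy.exists_right (h : IsSyzygy S G) :
    ∃ (P G' : ModuleCat.{u} S) (j : G →ₗ[S] P) (q : P →ₗ[S] G'), Module.Projective S P ∧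
      IsSyzygy S G' ∧ Function.Injective j ∧ Function.Exact j q ∧ Function.Surjective q ∧
      ∀ (Q : Type u) [AddCommGroup Q] [Module S Q], Module.Projective S Q →
        ∀ φ : G →ₗ[S] Q, ∃ ψ : P →ₗ[S] Q, ψ ∘ₗ j = φ := by
  obtain ⟨C, n, ⟨e⟩⟩ := h
  obtain ⟨n, rfl⟩ : ∃ m, n = m + 1 := ⟨n - 1, by ring⟩
  refine ⟨C.P (n + 1 + 1), ModuleCat.of S (LinearMap.range (C.d (n + 1 + 1))),
    (LinearMap.range (C.d (n + 1))).subtype ∘ₗ e.toLinearMap,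
    (C.d (n + 1 + 1)).rangeRestrict, C.projective _, ⟨C, _, ⟨LinearEquiv.refl _ _⟩⟩,
    Subtype.val_injective.comp e.injective, ?_, LinearMap.surjective_rangeRestrict _, ?_⟩
  · intro x
    rw [← Submodule.coe_eq_zero]
    refine (C.exact (n + 1) x).trans ⟨?_, ?_⟩
    · rintro ⟨y, rfl⟩
      exact ⟨e.symm ⟨_, y, rfl⟩, by simp⟩
    · rintro ⟨y, rfl⟩
      exact (e y).2
  · intro Q _ _ hQ φ
    obtain ⟨k, hk⟩ := (C.hom_exact Q hQ n
      (φ ∘ₗ e.symm.toLinearMap ∘ₗ (C.d (n + 1)).rangeRestrict)).1 (by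
        ext x
        have : (C.d (n + 1)).rangeRestrict (C.d n x) = 0 :=
          Subtype.ext ((C.exact n).apply_apply_eq_zero x)
        simp [this])
    refine ⟨k, LinearMap.ext fun x => ?_⟩
    obtain ⟨y, hy⟩ := (e x).2
    have h1 := LinearMap.congr_fun hk y
    have h2 : (C.d (n + 1)).rangeRestrict y = e x := Subtype.ext hy
    simp only [LinearMap.comp_apply, h2, LinearEquiv.coe_coe, e.symm_apply_apply] at h1
    rw [← h1, hy]; rfl

theorem IsSyzygy.exists_left (h : IsSyzygy S G) :
    ∃ (P : ModuleCat.{u} S) (q : P →ₗ[S] G), Module.Projective S P ∧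
      IsSyzygy S (LinearMap.ker q) ∧ Function.Surjective q ∧
      ∀ (Q : Type u) [AddCommGroup Q] [Module S Q], Module.Projective S Q →
        ∀ φ : LinearMap.ker q →ₗ[S] Q, ∃ ψ : P →ₗ[S] Q, ψ ∘ₗ (LinearMap.ker q).subtype = φ := by
  obtain ⟨C, n, ⟨e⟩⟩ := h
  obtain ⟨n, rfl⟩ : ∃ m, n = m + 1 := ⟨n - 1, by ring⟩
  -- A second shift: the kernel is the image one step before `G`, and extending maps from it uses
  -- the differential before that.
  obtain ⟨n, rfl⟩ : ∃ m, n = m + 1 := ⟨n - 1, by ring⟩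
  have hker : LinearMap.ker (e.symm.toLinearMap ∘ₗ (C.d (n + 1 + 1)).rangeRestrict) =
      LinearMap.range (C.d (n + 1)) := by
    rw [← LinearMap.exact_iff.1 (C.exact (n + 1))]
    ext x
    simp
  refine ⟨C.P (n + 1 + 1), e.symm.toLinearMap ∘ₗ (C.d (n + 1 + 1)).rangeRestrict,
    C.projective _, ⟨C, n + 1, ⟨LinearEquiv.ofEq _ _ hker⟩⟩,
    e.symm.surjective.comp (LinearMap.surjective_rangeRestrict _), ?_⟩
  rw [hker]
  intro Q _ _ hQ φ
  obtain ⟨k, hk⟩ := (C.hom_exact Q hQ n (φ ∘ₗ (C.d (n + 1)).rangeRestrict)).1 (by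
    ext x
    have : (C.d (n + 1)).rangeRestrict (C.d n x) = 0 :=
      Subtype.ext ((C.exact n).apply_apply_eq_zero x)
    simp [this])
  refine ⟨k, LinearMap.ext ?_⟩
  rintro ⟨_, y, rfl⟩
  exact LinearMap.congr_fun hk y

end Generic
end GorTranspose
namespace GorTranspose

/-! ### Replacing syzygies by finitely generated ones -/

section Steps

variable {S : Type u} [Ring S]

/-- A short exact sequence `0 → M → S^n → N → 0` with `n` finite such that every map from `M` to
a projective module extends to `S^n`. -/
def IsFreeExtension (S : Type u) [Ring S] (M N : Type u) [AddCommGroup M] [Module S M]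
    [AddCommGroup N] [Module S N] : Prop :=
  ∃ (n : ℕ) (i : M →ₗ[S] (Fin n → S)) (p : (Fin n → S) →ₗ[S] N),
    Function.Injective i ∧ Function.Exact i p ∧ Function.Surjective p ∧
    ∀ (Q : Type u) [AddCommGroup Q] [Module S Q], Module.Projective S Q →
      ∀ φ : M →ₗ[S] Q, ∃ ψ : (Fin n → S) →ₗ[S] Q, ψ ∘ₗ i = φ

/-- `M` is finitely generated and becomes a syzygy of a complete projective resolution after
adding a projective module. -/
def IsStableSyzygy (S : Type u) [Ring S] (M : Type u) [AddCommGroup M] [Module S M] : Prop :=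
  Module.Finite S M ∧ ∃ F : ModuleCat.{u} S, Module.Projective S F ∧ IsSyzygy S (M × F)

/-- Two linear surjections with the same kernel have isomorphic targets. -/
theorem nonempty_equiv_of_ker_eq {P M N : Type u} [AddCommGroup P] [Module S P]
    [AddCommGroup M] [Module S M] [AddCommGroup N] [Module S N] {f : P →ₗ[S] M} {g : P →ₗ[S] N}
    (hf : Function.Surjective f) (hg : Function.Surjective g)
    (h : LinearMap.ker f = LinearMap.ker g) : Nonempty (M ≃ₗ[S] N) :=
  ⟨(f.quotKerEquivOfSurjective hf).symm ≪≫ₗ Submodule.quotEquivOfEq _ _ h ≪≫ₗ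
    g.quotKerEquivOfSurjective hg⟩

variable {G : Type u} [AddCommGroup G] [Module S G]

/-- The projective `P` is a summand of a free module; the complement `ker π` is absorbed into the
cokernel, which stays a syzygy. -/
theorem IsSyzygy.exists_right_free (h : IsSyzygy S G) :
    ∃ (ι : Type u) (G' : ModuleCat.{u} S) (j : G →ₗ[S] (ι →₀ S)) (q : (ι →₀ S) →ₗ[S] G'),
      IsSyzygy S G' ∧ Function.Injective j ∧ Function.Exact j q ∧ Function.Surjective q ∧
      ∀ (Q : Type u) [AddCommGroup Q] [Module S Q], Module.Projective S Q →
        ∀ φ : G →ₗ[S] Q, ∃ ψ : (ι →₀ S) →ₗ[S] Q, ψ ∘ₗ j = φ := by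
  obtain ⟨P, G', j, q, hP, hG', hj, hjq, hq, hext⟩ := h.exists_right
  let π : (P →₀ S) →ₗ[S] P := Finsupp.linearCombination S id
  obtain ⟨s, hs⟩ : ∃ s : P →ₗ[S] (P →₀ S), π ∘ₗ s = LinearMap.id :=
    Module.projective_lifting_property π LinearMap.id (Finsupp.linearCombination_id_surjective S P)
  have hs' : ∀ x, π (s x) = x := fun x => LinearMap.congr_fun hs x
  let ρ : (P →₀ S) →ₗ[S] LinearMap.ker π :=
    (LinearMap.id - s ∘ₗ π).codRestrict _ (fun x => by simp [hs'])
  have hρ : ∀ x, (ρ x : P →₀ S) = x - s (π x) := fun x => rfl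
  have : Module.Projective S (LinearMap.ker π) :=
    Module.Projective.of_split (LinearMap.ker π).subtype ρ (by
      ext x
      simp [hρ])
  refine ⟨P, ModuleCat.of S (G' × LinearMap.ker π), s ∘ₗ j, (q ∘ₗ π).prod ρ, hG'.prod _,
    (Function.LeftInverse.injective hs').comp hj, ?_, ?_, ?_⟩
  · intro x
    constructor
    · intro hx
      obtain ⟨h1, h2⟩ := Prod.ext_iff.1 hx
      obtain ⟨g, hg⟩ := (hjq _).1 h1
      refine ⟨g, ?_⟩
      have h3 : x - s (π x) = 0 := congrArg Subtype.val h2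
      rw [LinearMap.comp_apply, hg, ← sub_eq_zero.1 h3]
    · rintro ⟨g, rfl⟩
      refine Prod.ext ?_ (Subtype.ext ?_)
      · change q (π (s (j g))) = 0
        rw [hs', hjq.apply_apply_eq_zero]
      · change s (j g) - s (π (s (j g))) = 0
        rw [hs', sub_self]
  · rintro ⟨y, l⟩
    obtain ⟨x, rfl⟩ := hq y
    have hl : π l = 0 := l.2
    have hx : π (s x + l) = x := by rw [map_add, hs', hl, add_zero]
    refine ⟨s x + l, Prod.ext ?_ (Subtype.ext ?_)⟩
    · change q (π (s x + l)) = q x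
      rw [hx]
    · change s x + l - s (π (s x + l)) = l
      rw [hx, add_sub_cancel_left]
  · intro Q _ _ hQ φ
    obtain ⟨ψ, rfl⟩ := hext Q hQ φ
    exact ⟨ψ ∘ₗ π, LinearMap.ext fun x => by simp [hs']⟩

/-- A finitely generated submodule of a free module lies in a finite free direct summand with
free complement. -/
theorem exists_equiv_prod_of_fg (ι : Type u) (L : Submodule S (ι →₀ S)) (hL : L.FG) :
    ∃ (n : ℕ) (F : ModuleCat.{u} S) (e : (ι →₀ S) ≃ₗ[S] (Fin n → S) × F),
      Module.Projective S F ∧ ∀ x ∈ L, (e x).2 = 0 := by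
  classical
  obtain ⟨t, rfl⟩ := hL
  let s : Finset ι := t.biUnion Finsupp.support
  let e : (ι →₀ S) ≃ₗ[S] (Fin (Fintype.card s) → S) × ({i // i ∉ s} →₀ S) :=
    Finsupp.domLCongr (Equiv.sumCompl (fun i => i ∈ s)).symm ≪≫ₗ
      Finsupp.sumFinsuppLEquivProdFinsupp S ≪≫ₗ
      ((Finsupp.linearEquivFunOnFinite S S _ ≪≫ₗ
        LinearEquiv.funCongrLeft S S (Fintype.equivFin s).symm).prodCongr (LinearEquiv.refl S _))
  refine ⟨Fintype.card s, ModuleCat.of S ({i // i ∉ s} →₀ S), e,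
    inferInstanceAs (Module.Projective S ({i // i ∉ s} →₀ S)), ?_⟩
  have : Submodule.span S (t : Set (ι →₀ S)) ≤
      LinearMap.ker (LinearMap.snd S _ _ ∘ₗ e.toLinearMap) := by
    rw [Submodule.span_le]
    intro x hx
    refine Finsupp.ext fun i => ?_
    have h1 : (e x).2 i = x i := by simp [e]
    refine h1.trans (Finsupp.notMem_support_iff.1 fun hi => i.2 ?_)
    exact Finset.mem_biUnion.2 ⟨x, hx, hi⟩
  exact fun x hx => this hx

/-- Embed `G × F` in a free module. The image of `G` is finitely generated, so it lies in a finite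
free summand `S^n`, and `N = S^n / G` is the new module. -/
theorem IsStableSyzygy.exists_right (h : IsStableSyzygy S G) :
    ∃ N : ModuleCat.{u} S, IsStableSyzygy S N ∧ IsFreeExtension S G N := by
  obtain ⟨hfin, F, hF, hG⟩ := h
  obtain ⟨ι, G', j, q, hG', hj, hjq, hq, hext⟩ := hG.exists_right_free
  obtain ⟨n, F₁, e, hF₁, he⟩ := exists_equiv_prod_of_fg ι
    (LinearMap.range (j ∘ₗ LinearMap.inl S G F)) (Module.Finite.iff_fg.1 inferInstance)
  have he' : ∀ x : G, (e (j (x, 0))).2 = 0 := fun x => he _ ⟨x, rfl⟩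
  let i : G →ₗ[S] (Fin n → S) := LinearMap.fst S _ _ ∘ₗ e.toLinearMap ∘ₗ j ∘ₗ LinearMap.inl S G F
  have hi : ∀ x, e (j (x, 0)) = (i x, 0) := fun x => Prod.ext rfl (he' x)
  have hi' : ∀ x, e.symm (i x, 0) = j (x, 0) := fun x => by rw [← hi, e.symm_apply_apply]
  refine ⟨ModuleCat.of S ((Fin n → S) ⧸ LinearMap.range i),
    ⟨inferInstanceAs (Module.Finite S ((Fin n → S) ⧸ LinearMap.range i)), F₁, hF₁, ?_⟩,
    n, i, (LinearMap.range i).mkQ, ?_, ?_, Submodule.mkQ_surjective _, ?_⟩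
  -- Extending the projection to `F` gives `r`. Then `N × F₁` and `G' × F` are both the quotient of
  -- the free module by `j (G × 0)`, hence isomorphic.
  · obtain ⟨r, hr⟩ := hext F hF (LinearMap.snd S G F)
    have hr' : ∀ x a, r (j (x, a)) = a := fun x a => LinearMap.congr_fun hr (x, a)
    let f : (ι →₀ S) →ₗ[S] ((Fin n → S) ⧸ LinearMap.range i) × F₁ :=
      ((LinearMap.range i).mkQ.prodMap LinearMap.id) ∘ₗ e.toLinearMap
    let g : (ι →₀ S) →ₗ[S] G' × F := q.prod r
    have hf : Function.Surjective f :=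
      (Function.Surjective.prodMap (Submodule.mkQ_surjective _) Function.surjective_id).comp
        e.surjective
    have hg : Function.Surjective g := by
      rintro ⟨y, a⟩
      obtain ⟨x, rfl⟩ := hq y
      refine ⟨x + j (0, a - r x), Prod.ext ?_ ?_⟩
      · change q _ = _
        rw [map_add, hjq.apply_apply_eq_zero, add_zero]
      · change r _ = _
        rw [map_add, hr', add_sub_cancel]
    obtain ⟨k⟩ := nonempty_equiv_of_ker_eq hf hg (by
      ext x
      constructor
      · intro hx
        obtain ⟨h1, h2⟩ := Prod.ext_iff.1 hx
        obtain ⟨y, hy⟩ := (Submodule.Quotient.mk_eq_zero _).1 h1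
        have hx : x = j (y, 0) := by
          rw [← hi', hy, e.eq_symm_apply]
          exact Prod.ext rfl h2
        subst hx
        exact Prod.ext (hjq.apply_apply_eq_zero _) (hr' _ _)
      · intro hx
        obtain ⟨h1, h2⟩ := Prod.ext_iff.1 hx
        obtain ⟨⟨y, a⟩, rfl⟩ := (hjq _).1 h1
        obtain rfl : a = 0 := (hr' y a).symm.trans h2
        refine Prod.ext ?_ (he' y)
        exact (Submodule.Quotient.mk_eq_zero _).2 ⟨y, rfl⟩)
    exact (hG'.prod F).of_equiv k
  · intro x y hxy
    have : j (x, 0) = j (y, 0) := by rw [← hi', ← hi', hxy]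
    exact (Prod.ext_iff.1 (hj this)).1
  · exact LinearMap.exact_map_mkQ_range i
  · intro Q _ _ hQ φ
    obtain ⟨ψ, hψ⟩ := hext Q hQ (φ ∘ₗ LinearMap.fst S G F)
    refine ⟨ψ ∘ₗ e.symm.toLinearMap ∘ₗ LinearMap.inl S _ _, LinearMap.ext fun x => ?_⟩
    change ψ (e.symm (i x, 0)) = φ x
    rw [hi']
    exact LinearMap.congr_fun hψ (x, 0)

/-- Schanuel's lemma. -/
theorem nonempty_ker_prod_equiv {P T : Type u} [AddCommGroup P] [Module S P] [AddCommGroup T]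
    [Module S T] {q : P →ₗ[S] G} {τ : T →ₗ[S] G} {a : P →ₗ[S] T} {b : T →ₗ[S] P}
    (ha : τ ∘ₗ a = q) (hb : q ∘ₗ b = τ) :
    Nonempty ((LinearMap.ker τ × P) ≃ₗ[S] (LinearMap.ker q × T)) := by
  have ha' : ∀ x, τ (a x) = q x := LinearMap.congr_fun ha
  have hb' : ∀ x, q (b x) = τ x := LinearMap.congr_fun hb
  exact ⟨{
    toFun := fun x => (⟨x.2 - b (x.1 + a x.2), by
      simp [ha', hb', LinearMap.mem_ker.1 x.1.2]⟩, x.1 + a x.2)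
    invFun := fun y => (⟨y.2 - a (y.1 + b y.2), by
      simp [ha', hb', LinearMap.mem_ker.1 y.1.2]⟩, y.1 + b y.2)
    map_add' := fun x y => Prod.ext (Subtype.ext (by simp; abel)) (by simp; abel)
    map_smul' := fun c x => Prod.ext (Subtype.ext (by simp [smul_sub])) (by simp)
    left_inv := fun x => Prod.ext (Subtype.ext (by simp)) (by simp)
    right_inv := fun x => Prod.ext (Subtype.ext (by simp)) (by simp) }⟩

/-- Take `M = ker p` for any finite free cover `p` of `G`. Schanuel's lemma compares it with the
syzygy `ker q`, up to projective summands. -/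
theorem IsStableSyzygy.exists_left [IsNoetherianRing S] (h : IsStableSyzygy S G) :
    ∃ M : ModuleCat.{u} S, IsStableSyzygy S M ∧ IsFreeExtension S M G := by
  obtain ⟨hfin, F, hF, hG⟩ := h
  obtain ⟨P, q, hP, hK, hq, hext⟩ := hG.exists_left
  obtain ⟨n, p, hp⟩ := Module.Finite.exists_fin' S G
  let τ : (Fin n → S) × F →ₗ[S] G × F := p.prodMap LinearMap.id
  have hτ : Function.Surjective τ := Function.Surjective.prodMap hp Function.surjective_id
  obtain ⟨a, ha⟩ := Module.projective_lifting_property τ q hτ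
  obtain ⟨b, hb⟩ := Module.projective_lifting_property q τ hq
  have ha' : ∀ x, τ (a x) = q x := LinearMap.congr_fun ha
  have hb' : ∀ x, q (b x) = τ x := LinearMap.congr_fun hb
  let c : LinearMap.ker τ ≃ₗ[S] LinearMap.ker p :=
    { toFun := fun x => ⟨x.1.1, (Prod.ext_iff.1 x.2).1⟩
      invFun := fun x => ⟨(x.1, 0), Prod.ext x.2 rfl⟩
      map_add' := fun _ _ => rfl
      map_smul' := fun _ _ => rfl
      left_inv := fun x => Subtype.ext (Prod.ext rfl (Prod.ext_iff.1 x.2).2.symm)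
      right_inv := fun _ => rfl }
  have hc : ∀ x : LinearMap.ker p, ((c.symm x : LinearMap.ker τ) : (Fin n → S) × F) = (x.1, 0) :=
    fun _ => rfl
  obtain ⟨e⟩ := nonempty_ker_prod_equiv ha hb
  refine ⟨ModuleCat.of S (LinearMap.ker p),
    ⟨inferInstanceAs (Module.Finite S (LinearMap.ker p)), P, hP, ?_⟩,
    n, (LinearMap.ker p).subtype, p, Subtype.val_injective, LinearMap.exact_subtype_ker_map p,
    hp, ?_⟩
  · exact (hK.prod ((Fin n → S) × F)).of_equiv
      ((c.symm.prodCongr (LinearEquiv.refl S P)).trans e)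
  · intro Q _ _ hQ (φ : LinearMap.ker p →ₗ[S] Q)
    let a₀ : LinearMap.ker q →ₗ[S] LinearMap.ker τ := a.restrict fun x hx => by
      rw [LinearMap.mem_ker, ha', hx]
    -- On `ker τ` the identity is `a ∘ b + δ`. The first summand passes through `ker q`, where maps
    -- extend to `P`; `δ` is already defined on the whole module.
    let δ : (Fin n → S) × F →ₗ[S] LinearMap.ker τ :=
      (LinearMap.id - a ∘ₗ b).codRestrict _ fun x => by simp [ha', hb']
    obtain ⟨ψ, hψ⟩ := hext Q hQ (φ ∘ₗ c.toLinearMap ∘ₗ a₀)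
    refine ⟨(ψ ∘ₗ b + φ ∘ₗ c.toLinearMap ∘ₗ δ) ∘ₗ LinearMap.inl S _ _, LinearMap.ext fun x => ?_⟩
    have hx : q (b (x.1, 0)) = 0 := by rw [hb']; exact Prod.ext x.2 rfl
    have h1 := LinearMap.congr_fun hψ ⟨b (x.1, 0), hx⟩
    have h2 : a₀ ⟨b (x.1, 0), hx⟩ + δ (x.1, 0) = c.symm x :=
      Subtype.ext (add_sub_cancel (a (b (x.1, 0))) (x.1, 0))
    change ψ (b (x.1, 0)) + φ (c (δ (x.1, 0))) = φ x
    change ψ (b (x.1, 0)) = φ (c (a₀ _)) at h1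
    rw [h1, ← map_add, ← map_add, h2, c.apply_symm_apply]

end Steps

/-! ### Splicing bi-infinite chains -/

/-- A relation that is total in both directions admits bi-infinite chains through any point. -/
theorem exists_int_chain {α : Type*} {r : α → α → Prop} (hr : ∀ a, ∃ b, r a b)
    (hl : ∀ b, ∃ a, r a b) (x : α) : ∃ t : ℤ → α, t 0 = x ∧ ∀ i, r (t i) (t (i + 1)) := by
  choose f hf using hr
  choose g hg using hl
  refine ⟨fun i => match i with
    | Int.ofNat k => f^[k] x
    -- `Int.negSucc k` is `-(k + 1)`, hence `k + 1` backward steps.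
    | Int.negSucc k => g^[k + 1] x, rfl, ?_⟩
  rintro (k | k)
  · change r (f^[k] x) (f^[k + 1] x)
    rw [Function.iterate_succ_apply']
    exact hf _
  · cases k with
    | zero => exact hg x
    | succ k =>
      have : Int.negSucc (k + 1) + 1 = Int.negSucc k := by omega
      rw [this]
      change r (g^[k + 1 + 1] x) (g^[k + 1] x)
      rw [Function.iterate_succ_apply' g (k + 1)]
      exact hg _

end GorTranspose
namespace GorTranspose

open MulOpposite

/-! ### Duality for finite free right modules -/

section Codual

variable {R : Type u} [Ring R]

/-- `R` and `Rᵐᵒᵖ` agree as right `R`-modules. -/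
def opRightLinearEquiv (R : Type u) [Ring R] : R ≃ₗ[Rᵐᵒᵖ] Rᵐᵒᵖ where
  toFun := op
  invFun := unop
  map_add' _ _ := rfl
  map_smul' _ _ := rfl
  left_inv _ := rfl
  right_inv _ := rfl

theorem projective_right_self : Module.Projective Rᵐᵒᵖ R :=
  Module.Projective.of_equiv (opRightLinearEquiv R).symm

/-- The dual `f^* : N^* → M^*` of a map `f : M → N` of right `R`-modules, as a map of left
`R`-modules. -/
def codualMap {M N : Type u} [AddCommGroup M] [Module Rᵐᵒᵖ M] [AddCommGroup N] [Module Rᵐᵒᵖ N]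
    (f : M →ₗ[Rᵐᵒᵖ] N) : (N →ₗ[Rᵐᵒᵖ] R) →ₗ[R] (M →ₗ[Rᵐᵒᵖ] R) where
  toFun φ := φ ∘ₗ f
  map_add' _ _ := rfl
  map_smul' _ _ := rfl

/-- The left `R`-module dual to the free right `R`-module of rank `n`. -/
abbrev FreeDual (R : Type u) [Ring R] (n : ℕ) : Type u := (Fin n → Rᵐᵒᵖ) →ₗ[Rᵐᵒᵖ] R

/-- The `j`-th coordinate functional. -/
def coordFunctional (R : Type u) [Ring R] {n : ℕ} (j : Fin n) : FreeDual R n :=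
  (opRightLinearEquiv R).symm.toLinearMap ∘ₗ LinearMap.proj j

@[simp]
theorem coordFunctional_apply {n : ℕ} (j : Fin n) (x : Fin n → Rᵐᵒᵖ) :
    coordFunctional R j x = unop (x j) := rfl

theorem sum_smul_coordFunctional {n : ℕ} (φ : FreeDual R n) :
    ∑ j, φ (Pi.single j 1) • coordFunctional R j = φ := by
  refine LinearMap.ext fun x => ?_
  conv_rhs => rw [← Finset.univ_sum_single x, map_sum]
  rw [LinearMap.sum_apply]
  refine Finset.sum_congr rfl fun j _ => ?_
  have : Pi.single j (x j) = x j • (Pi.single j 1 : Fin n → Rᵐᵒᵖ) := by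
    rw [← Pi.single_smul, smul_eq_mul, mul_one]
  rw [this, map_smul]
  rfl

theorem freeDual_hom_ext {n : ℕ} {Q : Type u} [AddCommGroup Q] [Module R Q]
    {f g : FreeDual R n →ₗ[R] Q} (h : ∀ j, f (coordFunctional R j) = g (coordFunctional R j)) :
    f = g := by
  refine LinearMap.ext fun φ => ?_
  rw [← sum_smul_coordFunctional φ, map_sum, map_sum]
  exact Finset.sum_congr rfl fun j _ => by rw [map_smul, map_smul, h]

/-- The dual of the free right module of rank `n` is the free left module of rank `n`. -/
def freeDualEquiv (R : Type u) [Ring R] (n : ℕ) : FreeDual R n ≃ₗ[R] (Fin n → R) where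
  toFun φ j := φ (Pi.single j 1)
  invFun c := ∑ j, c j • coordFunctional R j
  map_add' _ _ := rfl
  map_smul' _ _ := rfl
  left_inv φ := sum_smul_coordFunctional φ
  right_inv c := by
    funext k
    change (∑ j, c j • coordFunctional R j) (Pi.single k 1) = c k
    rw [LinearMap.sum_apply, Finset.sum_eq_single k]
    · simp
    · intro j _ hj
      simp [hj]
    · simp

instance (n : ℕ) : Module.Projective R (FreeDual R n) :=
  Module.Projective.of_equiv (freeDualEquiv R n).symm

instance (n : ℕ) : Module.Finite R (FreeDual R n) :=
  Module.Finite.equiv (freeDualEquiv R n).symm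

/-- Evaluation of functionals on a free right module. -/
def freeEval (R : Type u) [Ring R] (n : ℕ) :
    (Fin n → Rᵐᵒᵖ) →ₗ[Rᵐᵒᵖ] (FreeDual R n →ₗ[R] R) where
  toFun v :=
    { toFun := fun φ => φ v
      map_add' := fun _ _ => rfl
      map_smul' := fun _ _ => rfl }
  map_add' v w := LinearMap.ext fun φ => map_add φ v w
  map_smul' a v := LinearMap.ext fun φ => map_smul φ a v

theorem freeEval_surjective (n : ℕ) : Function.Surjective (freeEval R n) := fun g =>
  ⟨fun j => op (g (coordFunctional R j)), freeDual_hom_ext fun _ => rfl⟩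

theorem eq_zero_of_forall_freeDual {n : ℕ} {v : Fin n → Rᵐᵒᵖ} (h : ∀ φ : FreeDual R n, φ v = 0) :
    v = 0 :=
  funext fun j => unop_injective (h (coordFunctional R j))

/-- For `Q = R` this is reflexivity of finite free modules: dualizing twice returns `f` and `g`. A
projective `Q` embeds in a free module, where the argument runs coordinate by coordinate. -/
theorem exact_comp_codualMap {l m n : ℕ} {f : (Fin l → Rᵐᵒᵖ) →ₗ[Rᵐᵒᵖ] (Fin m → Rᵐᵒᵖ)}
    {g : (Fin m → Rᵐᵒᵖ) →ₗ[Rᵐᵒᵖ] (Fin n → Rᵐᵒᵖ)} (hfg : Function.Exact f g)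
    (Q : Type u) [AddCommGroup Q] [Module R Q] [Module.Projective R Q] :
    Function.Exact (fun h : FreeDual R l →ₗ[R] Q => h ∘ₗ codualMap f)
      (fun h : FreeDual R m →ₗ[R] Q => h ∘ₗ codualMap g) := by
  classical
  intro k
  constructor
  · intro hk
    obtain ⟨s, hs⟩ := Module.projective_lifting_property (Finsupp.linearCombination R (id : Q → Q))
      LinearMap.id (Finsupp.linearCombination_id_surjective R Q)
    choose v hv using fun x : Q => freeEval_surjective m (Finsupp.lapply x ∘ₗ s ∘ₗ k)
    have hv' : ∀ x φ, φ (v x) = s (k φ) x := fun x => LinearMap.congr_fun (hv x)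
    have hgv : ∀ x, g (v x) = 0 := fun x => eq_zero_of_forall_freeDual fun φ => by
      have : k (codualMap g φ) = 0 := LinearMap.congr_fun hk φ
      have h1 := hv' x (codualMap g φ)
      rw [this, map_zero] at h1
      exact h1
    choose w hw using fun x => (hfg (v x)).1 (hgv x)
    -- The dual is finitely generated, so only finitely many coordinates of `s ∘ k` are nonzero, and
    -- the sum defining the factorization is finite.
    let T : Finset Q := Finset.univ.biUnion fun j => (s (k (coordFunctional R j))).support
    refine ⟨∑ x ∈ T, (LinearMap.toSpanSingleton R Q x) ∘ₗ freeEval R l (w x),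
      freeDual_hom_ext fun j => ?_⟩
    have h1 : Finsupp.linearCombination R (id : Q → Q) (s (k (coordFunctional R j))) =
      k (coordFunctional R j) := LinearMap.congr_fun hs _
    rw [← h1, Finsupp.linearCombination_apply, Finsupp.sum_of_support_subset
      (s := T) _ (fun x hx => Finset.mem_biUnion.2 ⟨j, Finset.mem_univ _, hx⟩) _ (by simp)]
    rw [LinearMap.comp_apply, LinearMap.sum_apply]
    refine Finset.sum_congr rfl fun x _ => ?_
    rw [← hv', ← hw]
    rfl
  · rintro ⟨h, rfl⟩
    refine LinearMap.ext fun φ => ?_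
    have : codualMap f (codualMap g φ) = 0 :=
      LinearMap.ext fun x => by
        change φ (g (f x)) = 0
        rw [hfg.apply_apply_eq_zero, map_zero]
    change h (codualMap f (codualMap g φ)) = 0
    rw [this, map_zero]

/-! ### Realizing `H` as a cokernel of a dual -/

/-- A finitely generated Gorenstein projective right module is the cokernel of the dual of a
surjection from a finitely generated projective left module to a Gorenstein projective one. -/
theorem exists_cokerDual_equiv [IsNoetherianRing Rᵐᵒᵖ] {H : Type u} [AddCommGroup H]
    [Module Rᵐᵒᵖ H] [Module.Finite Rᵐᵒᵖ H] (hH : IsGorensteinProjective Rᵐᵒᵖ H) :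
    ∃ (Q K : ModuleCat.{u} R) (q : Q →ₗ[R] K), Module.Finite R Q ∧ Module.Projective R Q ∧
      IsGorensteinProjective R K ∧ Function.Surjective q ∧
      Nonempty (H ≃ₗ[Rᵐᵒᵖ] CokerDual q) := by
  have hH' : IsStableSyzygy Rᵐᵒᵖ H :=
    ⟨inferInstance, ModuleCat.of Rᵐᵒᵖ PUnit.{u+1},
      inferInstanceAs (Module.Projective Rᵐᵒᵖ PUnit.{u+1}), hH.isSyzygy.prod PUnit.{u+1}⟩
  obtain ⟨t, ht0, ht⟩ := exists_int_chain
    (α := {M : ModuleCat.{u} Rᵐᵒᵖ // IsStableSyzygy Rᵐᵒᵖ M})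
    -- Increasing indices move towards kernels, `0 → t (k+1) → F_k → t k → 0`, so that the dual
    -- complex has differentials raising the degree.
    (r := fun N M => IsFreeExtension Rᵐᵒᵖ M.1 N.1)
    (fun N => let ⟨M, h, h'⟩ := N.2.exists_left; ⟨⟨M, h⟩, h'⟩)
    (fun M => let ⟨N, h, h'⟩ := M.2.exists_right; ⟨⟨N, h⟩, h'⟩)
    ⟨ModuleCat.of Rᵐᵒᵖ H, hH'⟩
  choose n i p hi hip hp hext using ht
  replace hext : ∀ k (φ : (t (k + 1)).1 →ₗ[Rᵐᵒᵖ] R), ∃ ψ : FreeDual R (n k), ψ ∘ₗ i k = φ :=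
    fun k => hext k R projective_right_self
  let D : ∀ k, (Fin (n (k + 1)) → Rᵐᵒᵖ) →ₗ[Rᵐᵒᵖ] (Fin (n k) → Rᵐᵒᵖ) := fun k => i k ∘ₗ p (k + 1)
  have hD : ∀ k, Function.Exact (D (k + 1)) (D k) := fun k x => by
    change i k (p (k + 1) x) = 0 ↔ _
    rw [map_eq_zero_iff _ (hi k), hip (k + 1) x]
    constructor
    · rintro ⟨y, rfl⟩
      obtain ⟨z, rfl⟩ := hp _ y
      exact ⟨z, rfl⟩
    · rintro ⟨z, rfl⟩
      exact ⟨_, rfl⟩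
  -- Each `t k` is torsionless, since it embeds in the finite free module one step down.
  have hsep : ∀ k (x : (t k).1), (∀ φ : (t k).1 →ₗ[Rᵐᵒᵖ] R, φ x = 0) → x = 0 := by
    intro k x h
    obtain ⟨k, rfl⟩ : ∃ m, k = m + 1 := ⟨k - 1, by ring⟩
    refine (map_eq_zero_iff _ (hi k)).1 (eq_zero_of_forall_freeDual fun φ => ?_)
    exact h (φ ∘ₗ i k)
  let C : CompleteProjRes R :=
    { P := fun k => ModuleCat.of R (FreeDual R (n k))
      d := fun k => codualMap (D k)
      projective := fun k => inferInstanceAs (Module.Projective R (FreeDual R (n k)))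
      exact := fun k => by
        intro (φ : FreeDual R (n (k + 1)))
        constructor
        · intro hφ
          have h0 : ∀ z, φ (i (k + 1) z) = 0 := fun z => by
            obtain ⟨z, rfl⟩ := hp _ z
            exact LinearMap.congr_fun hφ z
          -- A cocycle descends along the surjection `p (k + 1)`; the descended functional then
          -- extends along `i k`.
          obtain ⟨χ, hχ⟩ : ∃ χ : (t (k + 1)).1 →ₗ[Rᵐᵒᵖ] R, χ ∘ₗ p (k + 1) = φ := by
            have hker : LinearMap.ker (p (k + 1)) ≤ LinearMap.ker φ := by
              intro x hx
              obtain ⟨z, rfl⟩ := (hip (k + 1) x).1 hx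
              exact h0 z
            refine ⟨(LinearMap.ker (p (k + 1))).liftQ φ hker ∘ₗ
              ((p (k + 1)).quotKerEquivOfSurjective (hp _)).symm.toLinearMap,
              LinearMap.ext fun x => ?_⟩
            have : ((p (k + 1)).quotKerEquivOfSurjective (hp _)).symm (p (k + 1) x) =
                Submodule.Quotient.mk x := by
              rw [LinearEquiv.symm_apply_eq]
              rfl
            simp [this]
          obtain ⟨ψ, rfl⟩ := hext k χ
          exact ⟨ψ, hχ⟩
        · rintro ⟨(ψ : FreeDual R (n k)), rfl⟩
          refine LinearMap.ext fun x => ?_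
          change ψ (D k (D (k + 1) x)) = 0
          rw [(hD k).apply_apply_eq_zero, map_zero]
      hom_exact := fun Q _ _ _ k => exact_comp_codualMap (hD k) Q }
  let q : FreeDual R (n 0) →ₗ[R] ((t (0 + 1)).1 →ₗ[Rᵐᵒᵖ] R) := codualMap (i 0)
  have hq : Function.Surjective q := hext 0
  have hK : IsGorensteinProjective R ((t (0 + 1)).1 →ₗ[Rᵐᵒᵖ] R) := by
    have hinj : Function.Injective (codualMap (R := R) (p (0 + 1))) := fun φ ψ h =>
      LinearMap.ext fun y => by
        obtain ⟨x, rfl⟩ := hp _ y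
        exact LinearMap.congr_fun h x
    have hr : LinearMap.range (codualMap (R := R) (p (0 + 1))) = LinearMap.range (C.d 0) := by
      apply SetLike.ext
      intro x
      constructor
      · rintro ⟨χ, rfl⟩
        obtain ⟨ψ, rfl⟩ := hq χ
        exact ⟨ψ, rfl⟩
      · rintro ⟨ψ, rfl⟩
        exact ⟨q ψ, rfl⟩
    exact ⟨C, ⟨(LinearEquiv.ofInjective _ hinj).trans (LinearEquiv.ofEq _ _ hr)⟩⟩
  have key : Nonempty ((t 0).1 ≃ₗ[Rᵐᵒᵖ] CokerDual q) := by
    refine nonempty_equiv_of_ker_eq (f := p 0)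
      (g := (LinearMap.range (dualMap q)).mkQ ∘ₗ freeEval R (n 0)) (hp 0)
      ((Submodule.mkQ_surjective _).comp (freeEval_surjective _)) ?_
    ext v
    rw [LinearMap.mem_ker, LinearMap.mem_ker, LinearMap.comp_apply, Submodule.mkQ_apply,
      Submodule.Quotient.mk_eq_zero]
    constructor
    · intro hv
      obtain ⟨x, rfl⟩ := (hip 0 v).1 hv
      exact ⟨{ toFun := fun χ => χ x
               map_add' := fun _ _ => rfl
               map_smul' := fun _ _ => rfl }, rfl⟩
    -- If evaluation at `v` factors through `q`, it kills the functionals pulled back from `t 0`,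
    -- because `q` does; so `p 0 v = 0` by torsionlessness.
    · rintro ⟨g, hg⟩
      refine hsep 0 _ fun φ => ?_
      have h1 : g (q (φ ∘ₗ p 0)) = φ (p 0 v) := LinearMap.congr_fun hg (φ ∘ₗ p 0)
      have h2 : q (φ ∘ₗ p 0) = 0 := LinearMap.ext fun x => by
        change φ (p 0 (i 0 x)) = 0
        rw [(hip 0).apply_apply_eq_zero, map_zero]
      rw [← h1, h2, map_zero]
  rw [ht0] at key
  exact ⟨ModuleCat.of R (FreeDual R (n 0)), ModuleCat.of R ((t (0 + 1)).1 →ₗ[Rᵐᵒᵖ] R), q,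
    inferInstanceAs (Module.Finite R (FreeDual R (n 0))),
    inferInstanceAs (Module.Projective R (FreeDual R (n 0))), hK, hq, key⟩

/-- The cokernel of the dual commutes with finite products. -/
theorem nonempty_cokerDual_prodMap_equiv {M N M' N' : Type u} [AddCommGroup M] [Module R M]
    [AddCommGroup N] [Module R N] [AddCommGroup M'] [Module R M'] [AddCommGroup N'] [Module R N']
    (f : M →ₗ[R] N) (g : M' →ₗ[R] N') :
    Nonempty ((CokerDual f × CokerDual g) ≃ₗ[Rᵐᵒᵖ] CokerDual (f.prodMap g)) := by
  let e : (M × M' →ₗ[R] R) →ₗ[Rᵐᵒᵖ] (M →ₗ[R] R) × (M' →ₗ[R] R) :=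
    { toFun := fun φ => (φ ∘ₗ LinearMap.inl R M M', φ ∘ₗ LinearMap.inr R M M')
      map_add' := fun _ _ => rfl
      map_smul' := fun _ _ => rfl }
  have he : Function.Surjective e := fun x =>
    ⟨x.1.coprod x.2, Prod.ext (LinearMap.coprod_inl _ _) (LinearMap.coprod_inr _ _)⟩
  refine nonempty_equiv_of_ker_eq
    (f := ((LinearMap.range (dualMap f)).mkQ.prodMap (LinearMap.range (dualMap g)).mkQ) ∘ₗ e)
    (g := (LinearMap.range (dualMap (f.prodMap g))).mkQ)
    ((Function.Surjective.prodMap (Submodule.mkQ_surjective _)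
      (Submodule.mkQ_surjective _)).comp he)
    (Submodule.mkQ_surjective _) ?_
  ext φ
  rw [Submodule.ker_mkQ, LinearMap.mem_ker]
  constructor
  · intro h
    obtain ⟨h1, h2⟩ := Prod.ext_iff.1 h
    obtain ⟨a, ha⟩ := (Submodule.Quotient.mk_eq_zero _).1 h1
    obtain ⟨b, hb⟩ := (Submodule.Quotient.mk_eq_zero _).1 h2
    exact ⟨a.coprod b, LinearMap.prod_ext (LinearMap.ext fun x => by
      simpa [dualMap, e] using LinearMap.congr_fun ha x) (LinearMap.ext fun x => by
      simpa [dualMap, e] using LinearMap.congr_fun hb x)⟩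
  · rintro ⟨c, rfl⟩
    refine Prod.ext ((Submodule.Quotient.mk_eq_zero _).2 ⟨c ∘ₗ LinearMap.inl R N N', ?_⟩)
      ((Submodule.Quotient.mk_eq_zero _).2 ⟨c ∘ₗ LinearMap.inr R N N', ?_⟩)
    · exact LinearMap.ext fun x => by simp [dualMap, e]
    · exact LinearMap.ext fun x => by simp [dualMap, e]

end Codual

end GorTranspose

/-! ### Adding the two presentations -/

theorem corollary3p2 (R : Type u) [Ring R] [IsNoetherianRing R] [IsNoetherianRing Rᵐᵒᵖ]
    (A : Type u) [AddCommGroup A] [Module R A] [Module.Finite R A]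
    (H : Type u) [AddCommGroup H] [Module Rᵐᵒᵖ H] [Module.Finite Rᵐᵒᵖ H]
    (hH : GorTranspose.IsGorensteinProjective Rᵐᵒᵖ H)
    (T : Type u) [AddCommGroup T] [Module Rᵐᵒᵖ T]
    (hT : GorTranspose.IsTranspose R A T) :
    GorTranspose.IsGorensteinTranspose R A (H × T) := by
  obtain ⟨Q, K, q, hQfin, hQ, hK, hq, ⟨eH⟩⟩ := GorTranspose.exists_cokerDual_equiv (R := R) hH
  obtain ⟨P₁, P₀, f, p, hfin₁, hfin₀, hP₁, hP₀, hfp, hp, ⟨eT⟩⟩ := hT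
  obtain ⟨e⟩ := GorTranspose.nonempty_cokerDual_prodMap_equiv q f
  have : Module.Finite R K := Module.Finite.of_surjective q hq
  refine ⟨ModuleCat.of R (Q × P₁), ModuleCat.of R (K × P₀), q.prodMap f,
    p ∘ₗ LinearMap.snd R K P₀, inferInstanceAs (Module.Finite R (Q × P₁)),
    inferInstanceAs (Module.Finite R (K × P₀)),
    GorTranspose.isGorensteinProjective_of_projective (G := Q × P₁), hK.prod P₀, ?_,
    hp.comp Prod.snd_surjective, ⟨(eH.prodCongr eT).trans e⟩⟩
  rintro ⟨k, x⟩
  refine (hfp x).trans ⟨?_, ?_⟩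
  · rintro ⟨y, rfl⟩
    -- Surjectivity of `q` makes all of `K` lie in the image, so the cokernel is still `A`.
    obtain ⟨z, rfl⟩ := hq k
    exact ⟨(z, y), rfl⟩
  · rintro ⟨⟨z, y⟩, h⟩
    exact ⟨y, (Prod.ext_iff.1 h).2⟩
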